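/- Let $r\ge 1$ be an integer and set $L(r)=\dfrac{(r+1)^{r+1}}{r^r}$. There is exactly one probability measure $F_{\langle r\rangle}$ on $\mathbb R$ with finite moments of all orders and $$\int_{\mathbb R}x^k\,dF_{\langle r\rangle}(x)=\frac{1}{k+1}\binom{(r+1)k}{k}\qquad (k=0,1,2,\dots).$$ This measure has a density $F'_{\langle r\rangle}\ge 0$ with respect to Lebesgue measure, which at every $x\neq 0$ is the derivative of the distribution function $x\mapsto F_{\langle r\rangle}((-\infty,x])$. The support of the density is $$\overline{\{x : F'_{\langle r\rangle}(x)>0\}}=[0,L(r)],$$ and there are constants $c,c'>0$ (depending only on $r$) such that $$F'_{\langle r\rangle}(x)\sim c\,x^{-\frac{r}{r+1}}\quad\text{as } x\searrow 0,\qquad F'_{\langle r\rangle}(x)\sim c'\sqrt{L(r)-x}\quad\text{as } x\nearrow L(r),$$ where $\sim$ means that the ratio of the two sides tends to $1$. -/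

import Mathlib

open MeasureTheory Filter Topology

namespace BlockShaped

/-- The right end point `L(r) = (r+1)^(r+1) / r^r` of the limiting spectrum. -/
noncomputable def rightEdge (r : ℕ) : ℝ := ((r : ℝ) + 1) ^ (r + 1) / (r : ℝ) ^ r

/-- The `k`-th limiting moment `m_k = (1/(k+1)) * binom((r+1)k, k)`. -/
noncomputable def limitMoment (r k : ℕ) : ℝ :=
  1 / ((k : ℝ) + 1) * (((r + 1) * k).choose k : ℝ)

/-- `μ` is the distribution `F_⟨r⟩`: a probability measure on the real line all of whose
moments are finite, the `k`-th one being `limitMoment r k`. -/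
structure IsLimitLaw (r : ℕ) (μ : Measure ℝ) : Prop where
  isProbabilityMeasure : IsProbabilityMeasure μ
  integrable_pow : ∀ k : ℕ, Integrable (fun x : ℝ => x ^ k) μ
  integral_pow : ∀ k : ℕ, ∫ x, x ^ k ∂μ = limitMoment r k

/-- `f` is the density `F'` of the probability measure `μ`, whose distribution function is `F`:
`f` is nonnegative and measurable, `μ(dx) = f(x) dx`, and `f` is the derivative of the distribution
function of `μ` at every point outside `s` (an exceptional set where `F` may fail to be
differentiable). -/
structure IsDensityOff (s : Set ℝ) (μ : Measure ℝ) (f : ℝ → ℝ) : Prop where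
  measurable : Measurable f
  nonneg : ∀ x, 0 ≤ f x
  eq_withDensity : μ = volume.withDensity (fun x => ENNReal.ofReal (f x))
  hasDerivAt : ∀ x, x ∉ s → HasDerivAt (fun t => ProbabilityTheory.cdf μ t) (f x) x

end BlockShaped

/-!
The number `binom((r+1)k, k)` is the coefficient of `z ^ k` in `(1 + z) ^ ((r+1)k)`, that is, the
average of `((1 + z) ^ (r+1) / z) ^ k` against `dz / (2πi z)` over a closed curve around `0`. On the
curve `z = (sin φ / sin (rφ)) e ^ (i(r+1)φ)`, `|φ| ≤ π / (r + 1)`, the law of sines in the triangle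
`-1, 0, z` gives `arg (1 + z) = φ`, and hence

  `(1 + z) ^ (r+1) / z = sin ((r+1)φ) ^ (r+1) / (sin (rφ) ^ r sin φ) =: level r φ`

is real. So only the imaginary part `(r + 1) dφ` of `dz / z` contributes, and `binom((r+1)k, k)` is
the `k`-th moment of `level r φ` for `φ` uniform on `(0, π / (r + 1))` (`integral_level_pow`). All
powers of `z` other than `z⁻¹` have a primitive that is real on the real axis, so integrating over
the upper half of the curve by the fundamental theorem of calculus is enough, and no theorem of
Cauchy type is needed.

The factor `1 / (k + 1)` is the `k`-th moment of the uniform law on `(0, 1)`. The limit law is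
therefore the law of a product of two independent variables, one uniform on `(0, 1)`, the other
distributed as `level r φ`, and its density at `x` is the average of `1 / level r φ` over the `φ`
with `level r φ > x` (`edensity`, `isLimitLaw_limitLaw`). The function `level r` decreases strictly
from `L(r)` to `0` (`strictAntiOn_level`) and `1 / level r` has an elementary primitive, so that the
density at `level r φ` is `sin (rφ) ^ (r+1) / (π r sin ((r+1)φ) ^ r)` (`density_level`). Continuity
away from `0`, the support and the behaviour at both end points are read off from this
parametrization.

Uniqueness holds because the moments grow at most geometrically, so that they determine the
characteristic function (`IsLimitLaw.unique`).
-/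

namespace BlockShaped

open Real Set

/-! ### Quotients of sines -/

lemma sinc_pos_of_lt_pi {x : ℝ} (h0 : 0 ≤ x) (hx : x < π) : 0 < sinc x := by
  rcases h0.eq_or_lt with rfl | h0
  · simp
  · rw [sinc_of_ne_zero h0.ne']
    exact div_pos (sin_pos_of_pos_of_lt_pi h0 hx) h0

lemma mul_sinc_mul (a : ℝ) {x : ℝ} (hx : x ≠ 0) : a * sinc (a * x) = sin (a * x) / x := by
  rcases eq_or_ne a 0 with rfl | ha
  · simp
  · rw [sinc_of_ne_zero (mul_ne_zero ha hx)]
    field_simp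

/-- The quotient `sin (a x) / sin (b x)`, extended continuously to `x = 0` by `a / b`. -/
noncomputable def sineRatio (a b x : ℝ) : ℝ := a * sinc (a * x) / (b * sinc (b * x))

lemma sineRatio_zero (a b : ℝ) : sineRatio a b 0 = a / b := by simp [sineRatio]

lemma sineRatio_of_ne_zero (a b : ℝ) {x : ℝ} (hx : x ≠ 0) :
    sineRatio a b x = sin (a * x) / sin (b * x) := by
  rw [sineRatio, mul_sinc_mul a hx, mul_sinc_mul b hx, div_div_div_cancel_right₀ hx]

lemma sineRatio_pos {a b x : ℝ} (ha : 0 < a) (hb : 0 < b) (h0 : 0 ≤ x) (hax : a * x < π)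
    (hbx : b * x < π) : 0 < sineRatio a b x :=
  div_pos (mul_pos ha (sinc_pos_of_lt_pi (by positivity) hax))
    (mul_pos hb (sinc_pos_of_lt_pi (by positivity) hbx))

lemma continuousAt_sineRatio (a : ℝ) {b x : ℝ} (hb : 0 < b) (h0 : 0 ≤ x) (hbx : b * x < π) :
    ContinuousAt (sineRatio a b) x := by
  have h := (sinc_pos_of_lt_pi (by positivity) hbx).ne'
  have hc := continuous_sinc
  exact ContinuousAt.div (by fun_prop) (by fun_prop) (mul_ne_zero hb.ne' h)

lemma hasDerivAt_sineRatio (a : ℝ) {b x : ℝ} (hb : 0 < b) (h0 : 0 < x) (hbx : b * x < π) :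
    HasDerivAt (sineRatio a b)
      ((a * cos (a * x) * sin (b * x) - sin (a * x) * (b * cos (b * x))) / sin (b * x) ^ 2) x := by
  have hs : sin (b * x) ≠ 0 := (sin_pos_of_pos_of_lt_pi (by positivity) hbx).ne'
  have hd (c : ℝ) : HasDerivAt (fun y => sin (c * y)) (c * cos (c * x)) x := by
    simpa [mul_comm] using ((hasDerivAt_id x).const_mul c).sin
  refine ((hd a).div (hd b) hs).congr_of_eventuallyEq ?_
  filter_upwards [eventually_ne_nhds h0.ne'] with y hy
  exact sineRatio_of_ne_zero a b hy

/-- Up to a positive factor, the left side is the derivative of `sin (a x) / sin (b x)`. It vanishes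
at `0` and has derivative `(b ^ 2 - a ^ 2) sin (a x) sin (b x)`. -/
lemma sineRatio_deriv_numerator_neg {a b x : ℝ} (hb : 0 < b) (hab : b < a) (h0 : 0 < x)
    (hx : x ≤ π / a) : a * cos (a * x) * sin (b * x) - sin (a * x) * (b * cos (b * x)) < 0 := by
  have ha : 0 < a := hb.trans hab
  have hanti : StrictAntiOn
      (fun y => a * cos (a * y) * sin (b * y) - sin (a * y) * (b * cos (b * y)))
      (Icc 0 (π / a)) := by
    refine strictAntiOn_of_hasDerivWithinAt_neg (f' := fun y =>
      (b ^ 2 - a ^ 2) * (sin (a * y) * sin (b * y))) (convex_Icc _ _) (by fun_prop) ?_ ?_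
    · intro y _
      have hs (c : ℝ) : HasDerivAt (fun y => sin (c * y)) (c * cos (c * y)) y := by
        simpa [mul_comm] using ((hasDerivAt_id y).const_mul c).sin
      have hc (c : ℝ) : HasDerivAt (fun y => cos (c * y)) (-(c * sin (c * y))) y := by
        simpa [mul_comm] using ((hasDerivAt_id y).const_mul c).cos
      refine HasDerivAt.hasDerivWithinAt ?_
      refine ((((hc a).const_mul a).mul (hs b)).sub
        ((hs a).mul ((hc b).const_mul b))).congr_deriv ?_
      ring
    · intro y hy
      rw [interior_Icc] at hy
      have hay : a * y < π := by rw [mul_comm]; exact (lt_div_iff₀ ha).1 hy.2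
      have hby : b * y < π := lt_trans (mul_lt_mul_of_pos_right hab hy.1) hay
      have h1 := sin_pos_of_pos_of_lt_pi (mul_pos ha hy.1) hay
      have h2 := sin_pos_of_pos_of_lt_pi (mul_pos hb hy.1) hby
      exact mul_neg_of_neg_of_pos (by nlinarith) (mul_pos h1 h2)
  have := hanti (left_mem_Icc.2 (by positivity)) ⟨h0.le, hx⟩ h0
  simpa using this

lemma strictAntiOn_sineRatio {a b : ℝ} (hb : 0 < b) (hab : b < a) :
    StrictAntiOn (sineRatio a b) (Icc 0 (π / a)) := by
  have ha : 0 < a := hb.trans hab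
  have hlt {y : ℝ} (hy : y ≤ π / a) : b * y < π := by
    calc b * y ≤ b * (π / a) := by gcongr
      _ < a * (π / a) := by gcongr
      _ = π := by field_simp
  refine strictAntiOn_of_hasDerivWithinAt_neg (f' := fun y =>
    (a * cos (a * y) * sin (b * y) - sin (a * y) * (b * cos (b * y))) / sin (b * y) ^ 2)
    (convex_Icc _ _) ?_ ?_ ?_
  · exact fun y hy => (continuousAt_sineRatio a hb hy.1 (hlt hy.2)).continuousWithinAt
  · intro y hy
    rw [interior_Icc] at hy
    exact (hasDerivAt_sineRatio a hb hy.1 (hlt hy.2.le)).hasDerivWithinAt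
  · intro y hy
    rw [interior_Icc] at hy
    have := sin_pos_of_pos_of_lt_pi (mul_pos hb hy.1) (hlt hy.2.le)
    exact div_neg_of_neg_of_pos (sineRatio_deriv_numerator_neg hb hab hy.1 hy.2.le) (by positivity)

/-- The expansion `sinc (a √t) = 1 - a ^ 2 t / 6 + o(t)`. -/
lemma hasDerivWithinAt_sinc_sqrt {a : ℝ} (ha : 0 < a) :
    HasDerivWithinAt (fun t => sinc (a * √t)) (-(a ^ 2 / 6)) (Ici 0) 0 := by
  rw [hasDerivWithinAt_iff_tendsto_slope, Ici_sdiff_left, ← tendsto_sub_nhds_zero_iff]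
  have hlim : Tendsto (fun t : ℝ => a ^ 4 * t / 100) (𝓝[>] 0) (𝓝 0) := by
    have : Tendsto (fun t : ℝ => a ^ 4 * t / 100) (𝓝 0) (𝓝 (a ^ 4 * 0 / 100)) :=
      Continuous.tendsto (by fun_prop) _
    simpa using this.mono_left nhdsWithin_le_nhds
  refine squeeze_zero_norm' ?_ hlim
  have hsmall : ∀ᶠ t : ℝ in 𝓝[>] 0, |a * √t| ≤ 1 := by
    have : Tendsto (fun t : ℝ => |a * √t|) (𝓝 0) (𝓝 |a * √0|) :=
      Continuous.tendsto (by fun_prop) _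
    exact (this.mono_left nhdsWithin_le_nhds).eventually_le_const (by simp)
  filter_upwards [hsmall, self_mem_nhdsWithin] with t ht (h0 : 0 < t)
  have hs : 0 < √t := sqrt_pos.2 h0
  have hb := sin_bound ht
  set s := √t with hsdef
  have hts : t = s ^ 2 := (sq_sqrt h0.le).symm
  rw [slope_def_field, sqrt_zero, mul_zero, sinc_zero, sinc_of_ne_zero (by positivity), norm_eq_abs,
    ← hsdef, hts]
  have : (sin (a * s) / (a * s) - 1) / (s ^ 2 - 0) - -(a ^ 2 / 6)
      = (sin (a * s) - (a * s - (a * s) ^ 3 / 6)) / (a * s ^ 3) := by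
    field_simp
    ring
  rw [this, abs_div, abs_of_pos (show 0 < a * s ^ 3 by positivity), div_le_iff₀ (by positivity)]
  rw [abs_of_pos (show 0 < a * s by positivity)] at hb
  exact hb.trans (le_of_eq (by ring))

lemma hasDerivWithinAt_sineRatio_sqrt {a b : ℝ} (ha : 0 < a) (hb : 0 < b) :
    HasDerivWithinAt (fun t => sineRatio a b √t) (a / b * ((b ^ 2 - a ^ 2) / 6)) (Ici 0) 0 := by
  have h := ((hasDerivWithinAt_sinc_sqrt ha).const_mul a).div
    ((hasDerivWithinAt_sinc_sqrt hb).const_mul b) (by simpa using hb.ne')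
  refine h.congr_deriv ?_
  simp only [sqrt_zero, mul_zero, sinc_zero]
  field_simp
  ring

/-! ### The curve and the binomial moments -/

/-- The right end point `π / (r + 1)` of the range of the angle `φ`. -/
noncomputable def maxAngle (r : ℕ) : ℝ := π / (r + 1)

/-- The function `sin ((r+1)φ) ^ (r+1) / (sin (rφ) ^ r * sin φ)`, extended continuously to `φ = 0`.
It parametrizes the interval `[0, L(r)]` by the angle `φ ∈ [0, π / (r + 1)]`. -/
noncomputable def level (r : ℕ) (φ : ℝ) : ℝ :=
  sineRatio (r + 1) r φ ^ r * sineRatio (r + 1) 1 φ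

lemma maxAngle_pos (r : ℕ) : 0 < maxAngle r := by unfold maxAngle; positivity

lemma mul_maxAngle (r : ℕ) : ((r : ℝ) + 1) * maxAngle r = π := by
  unfold maxAngle; field_simp

lemma succ_mul_lt_pi {r : ℕ} {φ : ℝ} (hφ : φ < maxAngle r) : ((r : ℝ) + 1) * φ < π := by
  rw [← mul_maxAngle r]; gcongr

lemma mul_lt_pi {r : ℕ} {φ : ℝ} (hφ : φ ≤ maxAngle r) : (r : ℝ) * φ < π := by
  have := maxAngle_pos r
  rw [← mul_maxAngle r]
  nlinarith [mul_le_mul_of_nonneg_left hφ (Nat.cast_nonneg (α := ℝ) r)]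

lemma one_mul_lt_pi {r : ℕ} (hr : 1 ≤ r) {φ : ℝ} (h0 : 0 ≤ φ) (hφ : φ ≤ maxAngle r) :
    1 * φ < π := by
  have : (1 : ℝ) ≤ r := by exact_mod_cast hr
  exact (mul_le_mul_of_nonneg_right this h0).trans_lt (mul_lt_pi hφ)

lemma level_zero (r : ℕ) : level r 0 = rightEdge r := by
  simp only [level, sineRatio_zero, rightEdge, div_one, div_pow, pow_succ]
  ring

lemma level_of_pos {r : ℕ} {φ : ℝ} (h0 : 0 < φ) :
    level r φ = sin ((r + 1) * φ) ^ (r + 1) / (sin (r * φ) ^ r * sin φ) := by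
  rw [level, sineRatio_of_ne_zero _ _ h0.ne', sineRatio_of_ne_zero _ _ h0.ne', one_mul, div_pow,
    div_mul_div_comm, pow_succ]

lemma level_maxAngle (r : ℕ) : level r (maxAngle r) = 0 := by
  rw [level_of_pos (maxAngle_pos r), mul_maxAngle]
  simp

lemma level_pos {r : ℕ} (hr : 1 ≤ r) {φ : ℝ} (h0 : 0 ≤ φ) (hφ : φ < maxAngle r) :
    0 < level r φ := by
  have hr' : (0 : ℝ) < r := by exact_mod_cast hr
  have h := succ_mul_lt_pi hφ
  exact mul_pos (pow_pos (sineRatio_pos (by positivity) hr' h0 h (mul_lt_pi hφ.le)) _)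
    (sineRatio_pos (by positivity) one_pos h0 h (one_mul_lt_pi hr h0 hφ.le))

lemma continuousAt_level {r : ℕ} (hr : 1 ≤ r) {φ : ℝ} (h0 : 0 ≤ φ) (hφ : φ ≤ maxAngle r) :
    ContinuousAt (level r) φ := by
  have hr' : (0 : ℝ) < r := by exact_mod_cast hr
  exact ((continuousAt_sineRatio _ hr' h0 (mul_lt_pi hφ)).pow r).mul
    (continuousAt_sineRatio _ one_pos h0 (one_mul_lt_pi hr h0 hφ))

lemma continuousOn_level {r : ℕ} (hr : 1 ≤ r) : ContinuousOn (level r) (Icc 0 (maxAngle r)) :=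
  fun _ hφ => (continuousAt_level hr hφ.1 hφ.2).continuousWithinAt

lemma strictAntiOn_level {r : ℕ} (hr : 1 ≤ r) :
    StrictAntiOn (level r) (Icc 0 (maxAngle r)) := by
  have hr' : (0 : ℝ) < r := by exact_mod_cast hr
  intro x hx y hy hxy
  have hx' : x < maxAngle r := hxy.trans_le hy.2
  have h1 := strictAntiOn_sineRatio hr' (lt_add_one (r : ℝ)) hx hy hxy
  have h2 := strictAntiOn_sineRatio one_pos (lt_add_of_pos_left 1 hr') hx hy hxy
  have hnn {b : ℝ} (hb : 0 < b) (hby : b * y < π) : 0 ≤ sineRatio (r + 1) b y := by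
    rw [sineRatio_of_ne_zero _ _ (hx.1.trans_lt hxy).ne']
    refine div_nonneg (sin_nonneg_of_nonneg_of_le_pi (mul_nonneg (by positivity) hy.1) ?_)
      (sin_nonneg_of_nonneg_of_le_pi (mul_nonneg hb.le hy.1) hby.le)
    rw [← mul_maxAngle r]
    exact mul_le_mul_of_nonneg_left hy.2 (by positivity)
  have hpos1 := hnn hr' (mul_lt_pi hy.2)
  exact mul_lt_mul_of_le_of_lt_of_nonneg_of_pos (pow_le_pow_left₀ hpos1 h1.le r) h2
    (hnn one_pos (one_mul_lt_pi hr hy.1 hy.2)) (pow_pos (hpos1.trans_lt h1) r)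

lemma rightEdge_pos (r : ℕ) : 0 < rightEdge r := by
  rcases r.eq_zero_or_pos with rfl | hr
  · simp [rightEdge]
  · have : (0 : ℝ) < r := by exact_mod_cast hr
    unfold rightEdge; positivity

/-- The angle is a coordinate on `(0, L(r))`. -/
lemma exists_level_eq {r : ℕ} (hr : 1 ≤ r) {x : ℝ} (h0 : 0 < x) (hx : x < rightEdge r) :
    ∃ φ ∈ Ioo 0 (maxAngle r), level r φ = x := by
  have := intermediate_value_Ioo' (maxAngle_pos r).le (continuousOn_level hr)
  rw [level_maxAngle, level_zero] at this
  exact this ⟨h0, hx⟩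

/-- The point `z` of the upper half plane such that the triangle `-1, 0, z` has the angle `φ` at
`-1` and the exterior angle `(r+1)φ` at `0`. By the law of sines `|z| = sin φ / sin (rφ)`. -/
noncomputable def curve (r : ℕ) (φ : ℝ) : ℂ :=
  sineRatio 1 r φ * Complex.exp ((((r + 1) * φ : ℝ) : ℂ) * Complex.I)

lemma curve_zero (r : ℕ) : curve r 0 = ((1 / r : ℝ) : ℂ) := by
  simp [curve, sineRatio_zero]

lemma curve_maxAngle {r : ℕ} (hr : 1 ≤ r) : curve r (maxAngle r) = ((-1 : ℝ) : ℂ) := by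
  have h0 := maxAngle_pos r
  have h : (r : ℝ) * maxAngle r = π - maxAngle r := by
    rw [← mul_maxAngle r]; ring
  have hs := sin_pos_of_pos_of_lt_pi h0 (by simpa using one_mul_lt_pi hr h0.le le_rfl)
  rw [curve, sineRatio_of_ne_zero _ _ h0.ne', mul_maxAngle, h, sin_pi_sub, one_mul,
    div_self hs.ne', Complex.exp_pi_mul_I]
  simp

lemma one_add_curve {r : ℕ} (hr : 1 ≤ r) {φ : ℝ} (h0 : 0 < φ) (hφ : φ < maxAngle r) :
    1 + curve r φ = sineRatio (r + 1) r φ * Complex.exp ((φ : ℂ) * Complex.I) := by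
  have hr' : (0 : ℝ) < r := by exact_mod_cast hr
  have hs : sin (r * φ) ≠ 0 :=
    (sin_pos_of_pos_of_lt_pi (by positivity) (mul_lt_pi hφ.le)).ne'
  have key : sin (r * φ) = sin ((r + 1) * φ) * cos φ - cos ((r + 1) * φ) * sin φ := by
    rw [← sin_sub]; ring_nf
  rw [curve, sineRatio_of_ne_zero _ _ h0.ne', sineRatio_of_ne_zero _ _ h0.ne', one_mul,
    Complex.exp_mul_I, Complex.exp_mul_I, ← Complex.ofReal_cos, ← Complex.ofReal_sin,
    ← Complex.ofReal_cos, ← Complex.ofReal_sin]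
  generalize sin (r * φ) = a, sin ((r + 1) * φ) = b, cos ((r + 1) * φ) = c, sin φ = d,
    cos φ = e at *
  have ha : (a : ℂ) ≠ 0 := by exact_mod_cast hs
  have key' : (a : ℂ) = b * e - c * d := by exact_mod_cast key
  push_cast
  field_simp
  linear_combination key'

lemma curve_ne_zero {r : ℕ} (hr : 1 ≤ r) {φ : ℝ} (h0 : 0 ≤ φ) (hφ : φ ≤ maxAngle r) :
    curve r φ ≠ 0 := by
  have hr' : (0 : ℝ) < r := by exact_mod_cast hr
  refine mul_ne_zero ?_ (Complex.exp_ne_zero _)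
  exact_mod_cast (sineRatio_pos one_pos hr' h0 (one_mul_lt_pi hr h0 hφ) (mul_lt_pi hφ)).ne'

/-- On the curve, `(1 + z) ^ (r + 1) / z` is real, with value `level r φ`. -/
lemma one_add_curve_pow {r : ℕ} (hr : 1 ≤ r) {φ : ℝ} (h0 : 0 < φ) (hφ : φ < maxAngle r) :
    (1 + curve r φ) ^ (r + 1) = level r φ * curve r φ := by
  have hs : sin φ ≠ 0 :=
    (sin_pos_of_pos_of_lt_pi h0 (by simpa using one_mul_lt_pi hr h0.le hφ.le)).ne'
  have h : sineRatio (r + 1) 1 φ * sineRatio 1 r φ = sineRatio (r + 1) r φ := by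
    simp only [sineRatio_of_ne_zero _ _ h0.ne', one_mul]
    field_simp
  rw [one_add_curve hr h0 hφ, curve, level, mul_pow, ← Complex.exp_nat_mul, pow_succ, ← h]
  push_cast
  ring_nf

lemma continuousOn_curve {r : ℕ} (hr : 1 ≤ r) :
    ContinuousOn (curve r) (Icc 0 (maxAngle r)) := by
  have hr' : (0 : ℝ) < r := by exact_mod_cast hr
  intro φ hφ
  have h : ContinuousAt (fun φ => (sineRatio 1 r φ : ℂ)) φ :=
    Complex.continuous_ofReal.continuousAt.comp
      (continuousAt_sineRatio 1 hr' hφ.1 (mul_lt_pi hφ.2))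
  have h2 : ContinuousAt (fun φ : ℝ => Complex.exp ((((r + 1) * φ : ℝ) : ℂ) * Complex.I)) φ := by
    fun_prop
  exact (h.mul h2).continuousWithinAt

lemma exists_hasDerivAt_curve {r : ℕ} (hr : 1 ≤ r) {φ : ℝ} (h0 : 0 < φ) (hφ : φ < maxAngle r) :
    ∃ t : ℝ, HasDerivAt (curve r) (curve r φ * ((t : ℂ) + ((r + 1 : ℝ) : ℂ) * Complex.I)) φ := by
  have hr' : (0 : ℝ) < r := by exact_mod_cast hr
  have h := (hasDerivAt_sineRatio 1 hr' h0 (mul_lt_pi hφ.le)).ofReal_comp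
  have hpos := sineRatio_pos one_pos hr' h0.le (one_mul_lt_pi hr h0.le hφ.le) (mul_lt_pi hφ.le)
  have hne : (sineRatio 1 r φ : ℂ) ≠ 0 := by exact_mod_cast hpos.ne'
  generalize (1 * cos (1 * φ) * sin (r * φ) - sin (1 * φ) * (r * cos (r * φ))) /
    sin (r * φ) ^ 2 = d at h
  have he : HasDerivAt (fun φ : ℝ => Complex.exp ((((r + 1) * φ : ℝ) : ℂ) * Complex.I))
      (Complex.exp ((((r + 1) * φ : ℝ) : ℂ) * Complex.I) * (((r + 1 : ℝ) : ℂ) * Complex.I)) φ := by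
    have := (((hasDerivAt_id φ).const_mul ((r : ℝ) + 1)).ofReal_comp.mul_const Complex.I).cexp
    simpa using this
  refine ⟨d / sineRatio 1 r φ, (h.mul he).congr_deriv ?_⟩
  rw [curve]
  push_cast
  field_simp

/-- The antiderivative of the Laurent polynomial `((1 + z) ^ ((r+1)k) / z ^ k - m) / z`, where `m`
is the constant term `binom((r+1)k, k)` of the quotient. -/
noncomputable def laurentPrimitive (r k : ℕ) (z : ℂ) : ℂ :=
  ∑ n ∈ (Finset.range ((r + 1) * k + 1)).erase k,
    (((r + 1) * k).choose n : ℂ) * (z ^ ((n : ℤ) - k) / ((n : ℤ) - k : ℤ))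

lemma hasDerivAt_laurentPrimitive (r k : ℕ) {z : ℂ} (hz : z ≠ 0) :
    HasDerivAt (laurentPrimitive r k)
      (((1 + z) ^ ((r + 1) * k) / z ^ k - (((r + 1) * k).choose k : ℂ)) / z) z := by
  have hk : k ∈ Finset.range ((r + 1) * k + 1) := by
    rw [Finset.mem_range]; nlinarith [Nat.zero_le (r * k)]
  have hsum : (1 + z) ^ ((r + 1) * k) = ∑ n ∈ Finset.range ((r + 1) * k + 1),
      z ^ n * (((r + 1) * k).choose n : ℂ) := by
    rw [add_comm, add_pow]; simp
  have : HasDerivAt (laurentPrimitive r k)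
      (∑ n ∈ (Finset.range ((r + 1) * k + 1)).erase k,
        z ^ n * (((r + 1) * k).choose n : ℂ) / z ^ k / z) z := by
    unfold laurentPrimitive
    refine HasDerivAt.fun_sum fun n hn => ?_
    have hne : (((n : ℤ) - k : ℤ) : ℂ) ≠ 0 := by
      have := Finset.ne_of_mem_erase hn
      exact Int.cast_ne_zero.2 (by lia)
    refine (((hasDerivAt_zpow ((n : ℤ) - k) z (Or.inl hz)).div_const _).const_mul
      (((r + 1) * k).choose n : ℂ)).congr_deriv ?_
    rw [zpow_sub_one₀ hz, zpow_sub₀ hz, zpow_natCast, zpow_natCast]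
    field_simp
  refine this.congr_deriv ?_
  rw [hsum, ← Finset.sum_erase_add _ _ hk, ← Finset.sum_div, ← Finset.sum_div]
  have := pow_ne_zero k hz
  field_simp
  ring

lemma laurentPrimitive_ofReal_im (r k : ℕ) (x : ℝ) : (laurentPrimitive r k x).im = 0 := by
  have : laurentPrimitive r k x = ((∑ n ∈ (Finset.range ((r + 1) * k + 1)).erase k,
      (((r + 1) * k).choose n : ℝ) * (x ^ ((n : ℤ) - k) / ((n : ℤ) - k : ℤ)) : ℝ) : ℂ) := by
    simp [laurentPrimitive]
  rw [this, Complex.ofReal_im]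

/-- The coefficient `binom((r+1)k, k)` of `z ^ k` in `(1 + z) ^ ((r+1)k)`, as an average over the
curve. As the function `((1 + z) ^ (r+1) / z) ^ k` is real on the curve, only the imaginary part
`(r + 1) dφ` of `dz / z` contributes. -/
lemma integral_level_pow {r : ℕ} (hr : 1 ≤ r) (k : ℕ) :
    ∫ φ in (0 : ℝ)..maxAngle r, level r φ ^ k = maxAngle r * (((r + 1) * k).choose k : ℝ) := by
  have hpos := maxAngle_pos r
  set m : ℝ := (((r + 1) * k).choose k : ℝ) with hm
  have hcont : ContinuousOn (fun φ => (laurentPrimitive r k (curve r φ)).im)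
      (Icc 0 (maxAngle r)) := by
    refine Complex.continuous_im.comp_continuousOn fun φ hφ => ?_
    exact (hasDerivAt_laurentPrimitive r k
      (curve_ne_zero hr hφ.1 hφ.2)).continuousAt.comp_continuousWithinAt
        (continuousOn_curve hr φ hφ)
  have hint : IntervalIntegrable (fun φ => level r φ ^ k) volume 0 (maxAngle r) := by
    refine ContinuousOn.intervalIntegrable ?_
    rw [uIcc_of_le hpos.le]
    exact (continuousOn_level hr).pow k
  have hderiv : ∀ φ ∈ Ioo 0 (maxAngle r), HasDerivAt
      (fun φ => (laurentPrimitive r k (curve r φ)).im) ((level r φ ^ k - m) * (r + 1)) φ := by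
    intro φ hφ
    have hz := curve_ne_zero hr hφ.1.le hφ.2.le
    -- the logarithmic derivative of the curve is `t + (r + 1) i` with a real `t`
    obtain ⟨t, ht⟩ := exists_hasDerivAt_curve hr hφ.1 hφ.2
    have h := ((hasDerivAt_laurentPrimitive r k hz).comp φ ht)
    have h' := (Complex.imCLM.hasFDerivAt.comp_hasDerivAt φ h)
    refine h'.congr_deriv ?_
    have : ((1 + curve r φ) ^ ((r + 1) * k) / curve r φ ^ k - (((r + 1) * k).choose k : ℂ)) /
        curve r φ * (curve r φ * ((t : ℂ) + ((r + 1 : ℝ) : ℂ) * Complex.I)) =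
        ((level r φ ^ k - m : ℝ) : ℂ) * ((t : ℂ) + ((r + 1 : ℝ) : ℂ) * Complex.I) := by
      rw [pow_mul, one_add_curve_pow hr hφ.1 hφ.2, mul_pow, hm]
      push_cast
      field_simp
    rw [this, Complex.imCLM_apply, Complex.im_ofReal_mul]
    simp
  have := intervalIntegral.integral_eq_sub_of_hasDerivAt_of_le hpos.le hcont hderiv
    ((hint.sub intervalIntegrable_const).mul_const _)
  rw [curve_zero, curve_maxAngle hr, laurentPrimitive_ofReal_im, laurentPrimitive_ofReal_im,
    intervalIntegral.integral_mul_const, intervalIntegral.integral_sub hint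
    intervalIntegrable_const, intervalIntegral.integral_const, sub_self, smul_eq_mul, sub_zero,
    mul_eq_zero, sub_eq_zero] at this
  exact this.resolve_right (by positivity)

/-! ### The density -/

/-- The density at the point `level r φ`, in terms of the angle:
`sin (rφ) ^ (r+1) / (π r sin ((r+1)φ) ^ r)`. -/
noncomputable def profile (r : ℕ) (φ : ℝ) : ℝ :=
  sineRatio r (r + 1) φ ^ r * sin (r * φ) / (π * r)

lemma profile_zero (r : ℕ) : profile r 0 = 0 := by simp [profile]

lemma profile_pos {r : ℕ} (hr : 1 ≤ r) {φ : ℝ} (h0 : 0 < φ) (hφ : φ < maxAngle r) :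
    0 < profile r φ := by
  have hr' : (0 : ℝ) < r := by exact_mod_cast hr
  have h1 := mul_lt_pi hφ.le
  have h2 := sineRatio_pos hr' (by positivity) h0.le h1 (succ_mul_lt_pi hφ)
  have h3 := sin_pos_of_pos_of_lt_pi (mul_pos hr' h0) h1
  unfold profile
  positivity

lemma continuousAt_profile {r : ℕ} {φ : ℝ} (h0 : 0 ≤ φ) (hφ : φ < maxAngle r) :
    ContinuousAt (profile r) φ := by
  have h := continuousAt_sineRatio r (b := (r : ℝ) + 1) (by positivity) h0 (succ_mul_lt_pi hφ)
  exact ((h.pow r).mul (by fun_prop)).div_const _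

lemma hasDerivAt_profile {r : ℕ} (hr : 1 ≤ r) {φ : ℝ} (h0 : 0 < φ) (hφ : φ < maxAngle r) :
    HasDerivAt (profile r) (1 / (maxAngle r * level r φ)) φ := by
  have hr' : (0 : ℝ) < r := by exact_mod_cast hr
  have h := hasDerivAt_sineRatio r (b := (r : ℝ) + 1) (by positivity) h0 (succ_mul_lt_pi hφ)
  have hs : HasDerivAt (fun y => sin (r * y)) (r * cos (r * φ)) φ := by
    simpa [mul_comm] using ((hasDerivAt_id φ).const_mul (r : ℝ)).sin
  refine (((h.pow r).mul hs).div_const (π * r)).congr_deriv ?_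
  have h1 := sin_pos_of_pos_of_lt_pi (mul_pos hr' h0) (mul_lt_pi hφ.le)
  have h2 := sin_pos_of_pos_of_lt_pi (by positivity) (succ_mul_lt_pi hφ)
  have h3 := sin_pos_of_pos_of_lt_pi h0 (by simpa using one_mul_lt_pi hr h0.le hφ.le)
  have key : sin φ = sin ((r + 1) * φ) * cos (r * φ) - cos ((r + 1) * φ) * sin (r * φ) := by
    rw [← sin_sub]; ring_nf
  rw [level_of_pos h0, maxAngle, Pi.pow_apply, sineRatio_of_ne_zero _ _ h0.ne']
  generalize sin (r * φ) = a, sin ((r + 1) * φ) = b, cos ((r + 1) * φ) = c, sin φ = d,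
    cos (r * φ) = e at *
  -- the derivative of the `r`-th power contains the truncated difference `r - 1`
  obtain ⟨m, rfl⟩ : ∃ m, r = m + 1 := ⟨r - 1, by lia⟩
  subst key
  simp only [Nat.add_sub_cancel, div_pow]
  field_simp
  push_cast
  ring

/-- The density of the product of a uniform variable on `(0, 1)` and an independent variable
`level r φ` with `φ` uniform on `(0, π / (r + 1))`. -/
noncomputable def edensity (r : ℕ) (x : ℝ) : ENNReal :=
  ∫⁻ φ in Ioo 0 (maxAngle r),
    if 0 < x ∧ x < level r φ then ENNReal.ofReal (1 / (maxAngle r * level r φ)) else 0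

/-- The real-valued version of `edensity`. -/
noncomputable def density (r : ℕ) (x : ℝ) : ℝ := (edensity r x).toReal

lemma measurable_level (r : ℕ) : Measurable (level r) := by
  have := continuous_sinc.measurable
  unfold level sineRatio
  fun_prop

lemma measurable_edensity_integrand (r : ℕ) : Measurable (fun p : ℝ × ℝ =>
    if 0 < p.1 ∧ p.1 < level r p.2 then
      ENNReal.ofReal (1 / (maxAngle r * level r p.2)) else 0) := by
  have := measurable_level r
  refine Measurable.ite ?_ (by fun_prop) measurable_const
  exact (measurableSet_lt measurable_const measurable_fst).inter
    (measurableSet_lt measurable_fst (by fun_prop))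

lemma measurable_edensity (r : ℕ) : Measurable (edensity r) :=
  (measurable_edensity_integrand r).lintegral_prod_right'

lemma edensity_of_nonpos (r : ℕ) {x : ℝ} (hx : x ≤ 0) : edensity r x = 0 := by
  simp [edensity, hx.not_gt]

lemma edensity_of_ge {r : ℕ} (hr : 1 ≤ r) {x : ℝ} (hx : rightEdge r ≤ x) : edensity r x = 0 := by
  rw [edensity, setLIntegral_congr_fun (g := 0) measurableSet_Ioo]
  · simp
  · intro φ hφ
    have := strictAntiOn_level hr (left_mem_Icc.2 (maxAngle_pos r).le) (Ioo_subset_Icc_self hφ) hφ.1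
    rw [level_zero] at this
    exact if_neg fun h => (h.2.trans (this.trans_le hx)).false

lemma edensity_level {r : ℕ} (hr : 1 ≤ r) {ψ : ℝ} (hψ : ψ ∈ Ioo 0 (maxAngle r)) :
    edensity r (level r ψ) = ENNReal.ofReal (profile r ψ) := by
  have hsub : Icc 0 ψ ⊆ Icc 0 (maxAngle r) := Icc_subset_Icc_right hψ.2.le
  have hcont : ContinuousOn (fun φ => 1 / (maxAngle r * level r φ)) (Icc 0 ψ) := by
    refine continuousOn_const.div (continuousOn_const.mul ((continuousOn_level hr).mono hsub)) ?_
    exact fun φ hφ => (mul_pos (maxAngle_pos r) (level_pos hr hφ.1 (hφ.2.trans_lt hψ.2))).ne'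
  have hint : IntervalIntegrable (fun φ => 1 / (maxAngle r * level r φ)) volume 0 ψ :=
    ContinuousOn.intervalIntegrable (by rwa [uIcc_of_le hψ.1.le])
  have hftc : ∫ φ in (0 : ℝ)..ψ, 1 / (maxAngle r * level r φ) = profile r ψ := by
    rw [intervalIntegral.integral_eq_sub_of_hasDerivAt_of_le hψ.1.le
      (fun φ hφ => (continuousAt_profile hφ.1 (hφ.2.trans_lt hψ.2)).continuousWithinAt)
      (fun φ hφ => hasDerivAt_profile hr hφ.1 (hφ.2.trans hψ.2)) hint, profile_zero, sub_zero]
  have hset : ∀ φ ∈ Ioo 0 (maxAngle r),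
      (if 0 < level r ψ ∧ level r ψ < level r φ then
        ENNReal.ofReal (1 / (maxAngle r * level r φ)) else 0) =
      (Iio ψ).indicator (fun φ => ENNReal.ofReal (1 / (maxAngle r * level r φ))) φ := by
    intro φ hφ
    rw [indicator_apply]
    refine if_congr ?_ rfl rfl
    rw [(strictAntiOn_level hr).lt_iff_gt (Ioo_subset_Icc_self hψ) (Ioo_subset_Icc_self hφ)]
    exact and_iff_right (level_pos hr hψ.1.le hψ.2)
  rw [edensity, setLIntegral_congr_fun measurableSet_Ioo hset,
    setLIntegral_indicator measurableSet_Iio, inter_comm, Ioo_inter_Iio, min_eq_right hψ.2.le,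
    ← hftc, intervalIntegral.integral_of_le hψ.1.le, integral_Ioc_eq_integral_Ioo,
    ofReal_integral_eq_lintegral_ofReal (hint.1.mono_set Ioo_subset_Ioc_self)]
  filter_upwards [ae_restrict_mem measurableSet_Ioo] with φ hφ
  have := level_pos hr hφ.1.le (hφ.2.trans hψ.2)
  have := maxAngle_pos r
  simp only [Pi.zero_apply]
  positivity

lemma edensity_ne_top {r : ℕ} (hr : 1 ≤ r) (x : ℝ) : edensity r x ≠ ⊤ := by
  rcases le_or_gt x 0 with h0 | h0
  · simp [edensity_of_nonpos r h0]
  rcases le_or_gt (rightEdge r) x with h1 | h1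
  · simp [edensity_of_ge hr h1]
  obtain ⟨φ, hφ, rfl⟩ := exists_level_eq hr h0 h1
  simp [edensity_level hr hφ]

lemma ofReal_density {r : ℕ} (hr : 1 ≤ r) (x : ℝ) : ENNReal.ofReal (density r x) = edensity r x :=
  ENNReal.ofReal_toReal (edensity_ne_top hr x)

lemma measurable_density (r : ℕ) : Measurable (density r) := (measurable_edensity r).ennreal_toReal

lemma density_nonneg (r : ℕ) (x : ℝ) : 0 ≤ density r x := ENNReal.toReal_nonneg

lemma density_of_nonpos (r : ℕ) {x : ℝ} (hx : x ≤ 0) : density r x = 0 := by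
  simp [density, edensity_of_nonpos r hx]

lemma density_of_ge {r : ℕ} (hr : 1 ≤ r) {x : ℝ} (hx : rightEdge r ≤ x) : density r x = 0 := by
  simp [density, edensity_of_ge hr hx]

lemma density_level {r : ℕ} (hr : 1 ≤ r) {φ : ℝ} (hφ : φ ∈ Ioo 0 (maxAngle r)) :
    density r (level r φ) = profile r φ := by
  rw [density, edensity_level hr hφ, ENNReal.toReal_ofReal (profile_pos hr hφ.1 hφ.2).le]

lemma density_pos_iff {r : ℕ} (hr : 1 ≤ r) {x : ℝ} :
    0 < density r x ↔ x ∈ Ioo 0 (rightEdge r) := by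
  refine ⟨fun h => ⟨?_, ?_⟩, fun h => ?_⟩
  · by_contra! h0
    simp [density_of_nonpos r h0] at h
  · by_contra! h0
    simp [density_of_ge hr h0] at h
  · obtain ⟨φ, hφ, rfl⟩ := exists_level_eq hr h.1 h.2
    rw [density_level hr hφ]
    exact profile_pos hr hφ.1 hφ.2

/-! ### Moments -/

/-- The law `F_⟨r⟩`. -/
noncomputable def limitLaw (r : ℕ) : Measure ℝ := volume.withDensity (edensity r)

lemma lintegral_limitLaw (r : ℕ) {h : ℝ → ENNReal} (hh : Measurable h) :
    ∫⁻ x, h x ∂limitLaw r = ∫⁻ φ in Ioo 0 (maxAngle r),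
      ENNReal.ofReal (1 / (maxAngle r * level r φ)) * ∫⁻ x in Ioo 0 (level r φ), h x := by
  have hm := measurable_edensity_integrand r
  rw [limitLaw, lintegral_withDensity_eq_lintegral_mul _ (measurable_edensity r) hh]
  calc ∫⁻ x, edensity r x * h x
      = ∫⁻ x, ∫⁻ φ in Ioo 0 (maxAngle r), (if 0 < x ∧ x < level r φ then
          ENNReal.ofReal (1 / (maxAngle r * level r φ)) else 0) * h x := by
        refine lintegral_congr fun x => ?_
        rw [edensity, lintegral_mul_const]
        exact hm.comp measurable_prodMk_left
    _ = ∫⁻ φ in Ioo 0 (maxAngle r), ∫⁻ x, (if 0 < x ∧ x < level r φ then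
          ENNReal.ofReal (1 / (maxAngle r * level r φ)) else 0) * h x :=
        lintegral_lintegral_swap (hm.mul (hh.comp measurable_fst)).aemeasurable
    _ = _ := by
        refine lintegral_congr fun φ => ?_
        rw [← lintegral_const_mul _ hh, ← lintegral_indicator measurableSet_Ioo]
        refine lintegral_congr fun x => ?_
        simp only [indicator_apply, mem_Ioo, ite_mul, zero_mul]

lemma lintegral_pow_limitLaw {r : ℕ} (hr : 1 ≤ r) (k : ℕ) :
    ∫⁻ x, ENNReal.ofReal (x ^ k) ∂limitLaw r = ENNReal.ofReal (limitMoment r k) := by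
  have hA := maxAngle_pos r
  have inner {y : ℝ} (hy : 0 ≤ y) : ∫⁻ x in Ioo 0 y, ENNReal.ofReal (x ^ k) =
      ENNReal.ofReal (y ^ (k + 1) / (k + 1)) := by
    have hint : IntervalIntegrable (fun x : ℝ => x ^ k) volume 0 y :=
      Continuous.intervalIntegrable (by fun_prop) _ _
    rw [← ofReal_integral_eq_lintegral_ofReal (hint.1.mono_set Ioo_subset_Ioc_self),
      ← integral_Ioc_eq_integral_Ioo, ← intervalIntegral.integral_of_le hy, integral_pow]
    · simp
    · filter_upwards [ae_restrict_mem measurableSet_Ioo] with x hx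
      exact pow_nonneg hx.1.le k
  have hint : IntervalIntegrable (fun φ => level r φ ^ k) volume 0 (maxAngle r) := by
    refine ContinuousOn.intervalIntegrable ?_
    rw [uIcc_of_le hA.le]
    exact (continuousOn_level hr).pow k
  have hcongr : ∀ φ ∈ Ioo 0 (maxAngle r), ENNReal.ofReal (1 / (maxAngle r * level r φ)) *
      ∫⁻ x in Ioo 0 (level r φ), ENNReal.ofReal (x ^ k) =
      ENNReal.ofReal ((1 / (maxAngle r * (k + 1))) * level r φ ^ k) := by
    intro φ hφ
    have := level_pos hr hφ.1.le hφ.2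
    rw [inner this.le, ← ENNReal.ofReal_mul (by positivity)]
    congr 1
    field_simp
    ring
  rw [lintegral_limitLaw r (by fun_prop), setLIntegral_congr_fun measurableSet_Ioo hcongr,
    ← ofReal_integral_eq_lintegral_ofReal ((hint.const_mul _).1.mono_set Ioo_subset_Ioc_self),
    ← integral_Ioc_eq_integral_Ioo, ← intervalIntegral.integral_of_le hA.le,
    intervalIntegral.integral_const_mul, integral_level_pow hr, limitMoment]
  · congr 1
    field_simp
  · filter_upwards [ae_restrict_mem measurableSet_Ioo] with φ hφ
    have := level_pos hr hφ.1.le hφ.2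
    simp only [Pi.zero_apply]
    positivity

lemma limitMoment_nonneg (r k : ℕ) : 0 ≤ limitMoment r k := by
  unfold limitMoment; positivity

lemma ae_pos_limitLaw (r : ℕ) : ∀ᵐ x ∂limitLaw r, 0 < x := by
  rw [limitLaw, ae_withDensity_iff (measurable_edensity r)]
  refine Eventually.of_forall fun x hx => ?_
  by_contra! h
  exact hx (edensity_of_nonpos r h)

theorem isLimitLaw_limitLaw {r : ℕ} (hr : 1 ≤ r) : IsLimitLaw r (limitLaw r) := by
  have hnn (k : ℕ) : 0 ≤ᵐ[limitLaw r] fun x : ℝ => x ^ k := by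
    filter_upwards [ae_pos_limitLaw r] with x hx
    exact pow_nonneg hx.le k
  have hlin (k : ℕ) := lintegral_pow_limitLaw hr k
  refine ⟨⟨?_⟩, fun k => ?_, fun k => ?_⟩
  · simpa [limitMoment] using hlin 0
  · refine ⟨by fun_prop, ?_⟩
    rw [hasFiniteIntegral_iff_ofReal (hnn k), hlin k]
    exact ENNReal.ofReal_lt_top
  · rw [integral_eq_lintegral_of_nonneg_ae (hnn k) (by fun_prop), hlin k,
      ENNReal.toReal_ofReal (limitMoment_nonneg r k)]

/-! ### Uniqueness -/

lemma limitMoment_le (r k : ℕ) : limitMoment r k ≤ (2 ^ (r + 1)) ^ k := by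
  have h1 : (((r + 1) * k).choose k : ℝ) ≤ 2 ^ ((r + 1) * k) := by
    exact_mod_cast Nat.choose_le_two_pow _ _
  have h2 : 1 / ((k : ℝ) + 1) ≤ 1 := by
    rw [div_le_one (by positivity)]
    linarith [Nat.cast_nonneg (α := ℝ) k]
  rw [← pow_mul, limitMoment]
  calc 1 / ((k : ℝ) + 1) * (((r + 1) * k).choose k : ℝ)
      ≤ 1 * (((r + 1) * k).choose k : ℝ) := by gcongr
    _ ≤ _ := by rwa [one_mul]

/-- The moments grow at most geometrically, so that the characteristic function is the sum of the
exponential series in the moments. -/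
lemma IsLimitLaw.hasSum_charFun {r : ℕ} {μ : Measure ℝ} (h : IsLimitLaw r μ) (t : ℝ) :
    HasSum (fun n : ℕ => ((t : ℂ) * Complex.I) ^ n / n.factorial * limitMoment r n)
      (charFun μ t) := by
  have := h.isProbabilityMeasure
  set F : ℕ → ℝ → ℂ := fun n x => ((t : ℂ) * Complex.I) ^ n / n.factorial * ((x ^ n : ℝ) : ℂ)
  have hF_int (n : ℕ) : Integrable (F n) μ := (h.integrable_pow n).ofReal.const_mul _
  -- odd absolute moments are not moments; bound them by even ones
  have habs (n : ℕ) : ∫ x, |x ^ n| ∂μ ≤ 1 + ((2 ^ (r + 1)) ^ 2) ^ n := by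
    calc ∫ x, |x ^ n| ∂μ ≤ ∫ x, (1 + x ^ (2 * n)) ∂μ := by
          refine integral_mono (h.integrable_pow n).abs
            ((integrable_const _).add (h.integrable_pow _)) fun x => ?_
          have hx : x ^ (2 * n) = |x ^ n| ^ 2 := by rw [sq_abs, mul_comm, pow_mul]
          change |x ^ n| ≤ 1 + x ^ (2 * n)
          rw [hx]
          nlinarith [sq_nonneg (|x ^ n| - 1), abs_nonneg (x ^ n)]
      _ = 1 + limitMoment r (2 * n) := by
          rw [integral_add (integrable_const _) (h.integrable_pow _), h.integral_pow]
          simp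
      _ ≤ _ := by
          rw [← pow_mul]
          gcongr
          exact limitMoment_le r _
  have hF_sum : Summable fun n => ∫ x, ‖F n x‖ ∂μ := by
    have h1 := Real.summable_pow_div_factorial |t|
    have h2 := Real.summable_pow_div_factorial (|t| * (2 ^ (r + 1)) ^ 2)
    refine Summable.of_nonneg_of_le (fun n => integral_nonneg fun x => norm_nonneg _)
      (fun n => ?_) (h1.add h2)
    have : ∀ x, ‖F n x‖ = |t| ^ n / n.factorial * |x ^ n| := fun x => by simp [F]
    simp_rw [this]
    rw [integral_const_mul]
    calc _ ≤ |t| ^ n / n.factorial * (1 + ((2 ^ (r + 1)) ^ 2) ^ n) := by gcongr; exact habs n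
      _ = _ := by rw [mul_pow]; ring
  have key := hasSum_integral_of_summable_integral_norm hF_int hF_sum
  have hterm (n : ℕ) : ∫ x, F n x ∂μ =
      ((t : ℂ) * Complex.I) ^ n / n.factorial * limitMoment r n := by
    rw [integral_const_mul, integral_complex_ofReal, h.integral_pow]
  have hexp : ∫ x, ∑' n, F n x ∂μ = charFun μ t := by
    rw [charFun_apply_real]
    refine integral_congr_ae (Eventually.of_forall fun x => ?_)
    change ∑' n, F n x = _
    rw [Complex.exp_eq_exp_ℂ, NormedSpace.exp_eq_tsum_div]
    refine tsum_congr fun n => ?_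
    simp only [F]
    push_cast
    ring
  simpa only [hterm, hexp] using key

theorem IsLimitLaw.unique {r : ℕ} {μ ν : Measure ℝ} (hμ : IsLimitLaw r μ) (hν : IsLimitLaw r ν) :
    μ = ν := by
  have := hμ.isProbabilityMeasure
  have := hν.isProbabilityMeasure
  exact Measure.ext_of_charFun (funext fun t => (hμ.hasSum_charFun t).unique (hν.hasSum_charFun t))

/-! ### Limits along the parametrization -/

section Filters

/-! A strictly decreasing continuous function maps (one-sided) neighbourhoods of a point onto
neighbourhoods of its image, so a limit in the angle `φ` is a limit in `x = level r φ`. -/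

variable {f : ℝ → ℝ} {a b c : ℝ}

lemma nhds_le_map_of_strictAntiOn (hf : ContinuousOn f (Icc a b)) (hanti : StrictAntiOn f (Icc a b))
    (hc : c ∈ Ioo a b) : 𝓝 (f c) ≤ map f (𝓝 c) := by
  intro S hS
  obtain ⟨u, v, huv, hsub⟩ := mem_nhds_iff_exists_Ioo_subset.1
    (inter_mem (mem_map.1 hS) (Ioo_mem_nhds hc.1 hc.2))
  have hlt : u < v := huv.1.trans huv.2
  obtain ⟨hau, hvb⟩ := (Ioo_subset_Ioo_iff hlt).1 (hsub.trans inter_subset_right)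
  have hIcc : Icc u v ⊆ Icc a b := Icc_subset_Icc hau hvb
  have hcm : c ∈ Icc a b := Ioo_subset_Icc_self hc
  refine mem_of_superset (Ioo_mem_nhds (hanti hcm (hIcc (right_mem_Icc.2 hlt.le)) huv.2)
    (hanti (hIcc (left_mem_Icc.2 hlt.le)) hcm huv.1)) ?_
  exact (intermediate_value_Ioo' hlt.le (hf.mono hIcc)).trans
    (image_subset_iff.2 (hsub.trans inter_subset_left))

lemma nhdsLT_le_map_of_strictAntiOn (hf : ContinuousOn f (Icc a b))
    (hanti : StrictAntiOn f (Icc a b)) (hab : a < b) : 𝓝[<] (f a) ≤ map f (𝓝[>] a) := by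
  intro S hS
  obtain ⟨u, hu, hsub⟩ := (mem_nhdsGT_iff_exists_mem_Ioc_Ioo_subset hab).1 (mem_map.1 hS)
  refine mem_of_superset (Ioo_mem_nhdsLT
    (hanti (left_mem_Icc.2 hab.le) (Ioc_subset_Icc_self hu) hu.1)) ?_
  exact (intermediate_value_Ioo' hu.1.le (hf.mono (Icc_subset_Icc_right hu.2))).trans
    (image_subset_iff.2 hsub)

lemma nhdsGT_le_map_of_strictAntiOn (hf : ContinuousOn f (Icc a b))
    (hanti : StrictAntiOn f (Icc a b)) (hab : a < b) : 𝓝[>] (f b) ≤ map f (𝓝[<] b) := by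
  intro S hS
  obtain ⟨u, hu, hsub⟩ := (mem_nhdsLT_iff_exists_mem_Ico_Ioo_subset hab).1 (mem_map.1 hS)
  refine mem_of_superset (Ioo_mem_nhdsGT
    (hanti (Ico_subset_Icc_self hu) (right_mem_Icc.2 hab.le) hu.2)) ?_
  exact (intermediate_value_Ioo' hu.2.le (hf.mono (Icc_subset_Icc_left hu.1))).trans
    (image_subset_iff.2 hsub)

end Filters

lemma nhdsLT_rightEdge_le_map {r : ℕ} (hr : 1 ≤ r) :
    𝓝[<] (rightEdge r) ≤ map (level r) (𝓝[>] 0) := by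
  rw [← level_zero]
  exact nhdsLT_le_map_of_strictAntiOn (continuousOn_level hr) (strictAntiOn_level hr)
    (maxAngle_pos r)

lemma nhdsGT_zero_le_map {r : ℕ} (hr : 1 ≤ r) :
    𝓝[>] 0 ≤ map (level r) (𝓝[<] (maxAngle r)) := by
  rw [← level_maxAngle r]
  exact nhdsGT_le_map_of_strictAntiOn (continuousOn_level hr) (strictAntiOn_level hr)
    (maxAngle_pos r)

lemma continuousAt_density {r : ℕ} (hr : 1 ≤ r) {x : ℝ} (hx : x ≠ 0) :
    ContinuousAt (density r) x := by
  rcases hx.lt_or_gt with h0 | h0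
  · refine (continuousAt_const (y := 0)).congr ?_
    filter_upwards [Iio_mem_nhds h0] with y hy
    exact (density_of_nonpos r (le_of_lt hy)).symm
  rcases lt_trichotomy x (rightEdge r) with h1 | rfl | h1
  · obtain ⟨φ, hφ, rfl⟩ := exists_level_eq hr h0 h1
    rw [ContinuousAt, density_level hr hφ]
    refine Tendsto.mono_left (tendsto_map'_iff.2 ?_)
      (nhds_le_map_of_strictAntiOn (continuousOn_level hr) (strictAntiOn_level hr) hφ)
    refine (continuousAt_profile hφ.1.le hφ.2).tendsto.congr' ?_
    filter_upwards [Ioo_mem_nhds hφ.1 hφ.2] with ψ hψ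
    exact (density_level hr hψ).symm
  · rw [continuousAt_iff_continuous_left'_right', ContinuousWithinAt, ContinuousWithinAt,
      density_of_ge hr le_rfl]
    constructor
    · refine Tendsto.mono_left (tendsto_map'_iff.2 ?_) (nhdsLT_rightEdge_le_map hr)
      have h := (continuousAt_profile le_rfl (maxAngle_pos r)).tendsto.mono_left
        (nhdsWithin_le_nhds (s := Ioi 0))
      rw [profile_zero] at h
      refine h.congr' ?_
      filter_upwards [Ioo_mem_nhdsGT (maxAngle_pos r)] with ψ hψ
      exact (density_level hr hψ).symm
    · refine tendsto_const_nhds.congr' ?_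
      filter_upwards [self_mem_nhdsWithin] with y hy
      exact (density_of_ge hr (le_of_lt hy)).symm
  · refine (continuousAt_const (y := 0)).congr ?_
    filter_upwards [Ioi_mem_nhds h1] with y hy
    exact (density_of_ge hr (le_of_lt hy)).symm

/-! ### The distribution function -/

lemma integrable_density {r : ℕ} (hr : 1 ≤ r) : Integrable (density r) := by
  refine ⟨(measurable_density r).aestronglyMeasurable, ?_⟩
  rw [hasFiniteIntegral_iff_ofReal (Eventually.of_forall (density_nonneg r))]
  simp_rw [ofReal_density hr]
  have := (isLimitLaw_limitLaw hr).isProbabilityMeasure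
  have h := measure_lt_top (limitLaw r) univ
  rwa [limitLaw, withDensity_apply _ MeasurableSet.univ, setLIntegral_univ] at h

lemma cdf_limitLaw {r : ℕ} (hr : 1 ≤ r) (t : ℝ) :
    ProbabilityTheory.cdf (limitLaw r) t = ∫ x in Iic t, density r x := by
  have := (isLimitLaw_limitLaw hr).isProbabilityMeasure
  rw [ProbabilityTheory.cdf_eq_real, measureReal_def, limitLaw,
    withDensity_apply _ measurableSet_Iic, integral_eq_lintegral_of_nonneg_ae
      (Eventually.of_forall (density_nonneg r)) (measurable_density r).aestronglyMeasurable]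
  simp_rw [ofReal_density hr]

lemma isDensityOff_density {r : ℕ} (hr : 1 ≤ r) : IsDensityOff {0} (limitLaw r) (density r) where
  measurable := measurable_density r
  nonneg := density_nonneg r
  eq_withDensity := by simp_rw [ofReal_density hr]; rfl
  hasDerivAt x hx := by
    have hint := integrable_density hr
    have h : (fun t => ProbabilityTheory.cdf (limitLaw r) t) =
        fun t => (∫ x in Iic 0, density r x) + ∫ x in (0 : ℝ)..t, density r x := by
      funext t
      rw [cdf_limitLaw hr, ← intervalIntegral.integral_Iic_sub_Iic hint.integrableOn
        hint.integrableOn]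
      ring
    rw [h]
    exact (intervalIntegral.integral_hasDerivAt_right hint.intervalIntegrable
      (measurable_density r).stronglyMeasurable.stronglyMeasurableAtFilter
      (continuousAt_density hr hx)).const_add _

/-! ### Behaviour at the end points -/

lemma hasDerivWithinAt_level_sqrt {r : ℕ} (hr : 1 ≤ r) :
    HasDerivWithinAt (fun t => level r √t) (-(rightEdge r * (r * (r + 1) / 2))) (Ici 0) 0 := by
  have hr' : (0 : ℝ) < r := by exact_mod_cast hr
  have h := ((hasDerivWithinAt_sineRatio_sqrt (a := (r : ℝ) + 1) (by positivity) hr').pow r).mul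
    (hasDerivWithinAt_sineRatio_sqrt (a := (r : ℝ) + 1) (by positivity) one_pos)
  refine h.congr_deriv ?_
  simp only [Pi.pow_apply, sqrt_zero, sineRatio_zero, rightEdge]
  obtain ⟨m, rfl⟩ : ∃ m, r = m + 1 := ⟨r - 1, by lia⟩
  simp only [Nat.add_sub_cancel, div_pow]
  field_simp
  push_cast
  ring

/-- The reason for the square root: at `φ = 0`, `profile` vanishes to first order and
`L(r) - level` to second order. -/
lemma exists_isEquivalent_rightEdge {r : ℕ} (hr : 1 ≤ r) :
    ∃ c' : ℝ, 0 < c' ∧ Asymptotics.IsEquivalent (𝓝[<] (rightEdge r)) (density r)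
      (fun x => c' * √(rightEdge r - x)) := by
  have hr' : (0 : ℝ) < r := by exact_mod_cast hr
  have hL := rightEdge_pos r
  set K : ℝ := rightEdge r * (r * (r + 1) / 2) with hK
  have hKpos : 0 < K := by positivity
  set A : ℝ := (r / (r + 1)) ^ r / π with hA
  have hApos : 0 < A := by positivity
  have hlevel : Tendsto (fun φ => (rightEdge r - level r φ) / φ ^ 2) (𝓝[>] 0) (𝓝 K) := by
    have h := hasDerivWithinAt_iff_tendsto_slope.1 (hasDerivWithinAt_level_sqrt hr)
    rw [Ici_sdiff_left] at h
    have hsq : Tendsto (fun φ : ℝ => φ ^ 2) (𝓝[>] 0) (𝓝[>] 0) := by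
      refine tendsto_nhdsWithin_iff.2 ⟨?_, ?_⟩
      · have : Tendsto (fun φ : ℝ => φ ^ 2) (𝓝 0) (𝓝 (0 ^ 2)) := (continuous_pow 2).tendsto 0
        simpa using this.mono_left nhdsWithin_le_nhds
      · filter_upwards [self_mem_nhdsWithin] with φ (hφ : 0 < φ)
        exact pow_pos hφ 2
    have h' := (h.comp hsq).neg
    rw [neg_neg] at h'
    refine h'.congr' ?_
    filter_upwards [self_mem_nhdsWithin] with φ (hφ : 0 < φ)
    simp only [Function.comp_apply, slope_def_field, sqrt_zero, level_zero, sqrt_sq hφ.le, sub_zero]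
    ring
  have hprofile : Tendsto (fun φ => profile r φ / φ) (𝓝[>] 0) (𝓝 A) := by
    have hc := continuous_sinc
    have h1 := continuousAt_sineRatio r (b := (r : ℝ) + 1) (x := 0) (by positivity) le_rfl
      (by simpa using pi_pos)
    have h2 : ContinuousAt (fun φ => sineRatio r (r + 1) φ ^ r * sinc (r * φ) / π) 0 :=
      ((h1.pow r).mul (by fun_prop)).div_const _
    have h3 := h2.tendsto.mono_left (nhdsWithin_le_nhds (s := Ioi 0))
    simp only [sineRatio_zero, mul_zero, sinc_zero, mul_one] at h3
    refine h3.congr' ?_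
    filter_upwards [self_mem_nhdsWithin] with φ (hφ : 0 < φ)
    rw [profile, sinc_of_ne_zero (by positivity)]
    field_simp
  refine ⟨A / √K, by positivity, Asymptotics.isEquivalent_of_tendsto_one ?_⟩
  refine Tendsto.mono_left (tendsto_map'_iff.2 ?_) (nhdsLT_rightEdge_le_map hr)
  have hlim := hprofile.div (hlevel.sqrt.const_mul (A / √K)) (by positivity)
  rw [div_mul_cancel₀ _ (by positivity), div_self hApos.ne'] at hlim
  refine hlim.congr' ?_
  filter_upwards [Ioo_mem_nhdsGT (maxAngle_pos r)] with φ hφ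
  have h0 := hφ.1
  simp only [Function.comp_apply, Pi.div_apply, density_level hr hφ]
  rw [sqrt_div' _ (by positivity), sqrt_sq h0.le]
  field_simp

/-- Since `level ^ (r / (r + 1))` vanishes at `φ = π / (r + 1)` exactly like `sin ((r+1)φ) ^ r`,
which is the denominator of `profile`, the product of the two functions is continuous there. -/
lemma exists_isEquivalent_zero {r : ℕ} (hr : 1 ≤ r) :
    ∃ c : ℝ, 0 < c ∧ Asymptotics.IsEquivalent (𝓝[>] 0) (density r)
      (fun x => c * x ^ (-((r : ℝ) / ((r : ℝ) + 1)))) := by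
  have hr' : (0 : ℝ) < r := by exact_mod_cast hr
  have hA := maxAngle_pos r
  have hpow {y : ℝ} (hy : 0 ≤ y) : (y ^ (r + 1)) ^ ((r : ℝ) / (r + 1)) = y ^ r := by
    rw [← rpow_natCast y (r + 1), ← rpow_mul hy]
    push_cast
    rw [mul_div_cancel₀ _ (by positivity), rpow_natCast]
  have hσ : 0 < sin (maxAngle r) :=
    sin_pos_of_pos_of_lt_pi hA (by simpa using one_mul_lt_pi hr hA.le le_rfl)
  have hsin : sin (r * maxAngle r) = sin (maxAngle r) := by
    rw [← sin_pi_sub]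
    congr 1
    rw [← mul_maxAngle r]
    ring
  have hlim : Tendsto (fun φ => sin (r * φ) ^ (r + 1) /
      (π * r * (sin (r * φ) ^ r * sin φ) ^ ((r : ℝ) / (r + 1)))) (𝓝[<] (maxAngle r))
      (𝓝 (sin (maxAngle r) / (π * r))) := by
    have h : ContinuousAt (fun φ => sin (r * φ) ^ (r + 1) /
        (π * r * (sin (r * φ) ^ r * sin φ) ^ ((r : ℝ) / (r + 1)))) (maxAngle r) := by
      refine ContinuousAt.div (by fun_prop) (continuousAt_const.mul
        (ContinuousAt.rpow_const (by fun_prop) (Or.inr (by positivity)))) ?_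
      rw [hsin]
      positivity
    have h' := h.tendsto.mono_left (nhdsWithin_le_nhds (s := Iio (maxAngle r)))
    rw [hsin, ← pow_succ, hpow hσ.le] at h'
    convert h' using 2
    field_simp
    ring
  refine ⟨sin (maxAngle r) / (π * r), by positivity, Asymptotics.isEquivalent_of_tendsto_one ?_⟩
  refine Tendsto.mono_left (tendsto_map'_iff.2 ?_) (nhdsGT_zero_le_map hr)
  have hlim' := hlim.div_const (sin (maxAngle r) / (π * r))
  rw [div_self (by positivity)] at hlim'
  refine hlim'.congr' ?_
  filter_upwards [Ioo_mem_nhdsLT hA] with φ hφ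
  have ha := sin_pos_of_pos_of_lt_pi (mul_pos hr' hφ.1) (mul_lt_pi hφ.2.le)
  have hb := sin_pos_of_pos_of_lt_pi (mul_pos (by positivity) hφ.1) (succ_mul_lt_pi hφ.2)
  have hd := sin_pos_of_pos_of_lt_pi hφ.1 (by simpa using one_mul_lt_pi hr hφ.1.le hφ.2.le)
  simp only [Function.comp_apply, Pi.div_apply, density_level hr hφ]
  rw [rpow_neg (level_pos hr hφ.1.le hφ.2).le, level_of_pos hφ.1, div_rpow (by positivity)
    (by positivity), hpow hb.le, profile, sineRatio_of_ne_zero _ _ hφ.1.ne']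
  have : 0 < (sin (r * φ) ^ r * sin φ) ^ ((r : ℝ) / (r + 1)) := by positivity
  generalize (sin (r * φ) ^ r * sin φ) ^ ((r : ℝ) / (r + 1)) = w,
    sin ((r + 1) * φ) = b at *
  rw [div_pow]
  field_simp
  ring

end BlockShaped

theorem corollary3 (r : ℕ) (hr : 1 ≤ r) :
    (∃! μ : Measure ℝ, BlockShaped.IsLimitLaw r μ) ∧
    ∀ μ : Measure ℝ, BlockShaped.IsLimitLaw r μ →
      ∃ f : ℝ → ℝ, BlockShaped.IsDensityOff {0} μ f ∧
        closure {x : ℝ | 0 < f x} = Set.Icc 0 (BlockShaped.rightEdge r) ∧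
        (∃ c : ℝ, 0 < c ∧
          Asymptotics.IsEquivalent (𝓝[>] (0 : ℝ)) f
            (fun x => c * x ^ (-((r : ℝ) / ((r : ℝ) + 1))))) ∧
        (∃ c' : ℝ, 0 < c' ∧
          Asymptotics.IsEquivalent (𝓝[<] (BlockShaped.rightEdge r)) f
            (fun x => c' * Real.sqrt (BlockShaped.rightEdge r - x))) := by
  have hlaw := BlockShaped.isLimitLaw_limitLaw hr
  refine ⟨⟨_, hlaw, fun μ hμ => hμ.unique hlaw⟩, fun μ hμ => ?_⟩
  obtain rfl := hμ.unique hlaw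
  refine ⟨BlockShaped.density r, BlockShaped.isDensityOff_density hr, ?_,
    BlockShaped.exists_isEquivalent_zero hr, BlockShaped.exists_isEquivalent_rightEdge hr⟩
  simp_rw [BlockShaped.density_pos_iff hr]
  exact closure_Ioo (BlockShaped.rightEdge_pos r).ne
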